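/- Let $(\mathcal C,\mathbb E,\mathfrak s)$ be an extriangulated category: $\mathcal C$ is an additive category, $\mathbb E\colon \mathcal C^{\mathrm{op}}\times\mathcal C\to \mathrm{Ab}$ is a biadditive functor, and $\mathfrak s$ is an additive realization satisfying (ET3), (ET4) and their duals. An equality $\mathfrak s(\delta)=[A\xrightarrow{f}B\xrightarrow{g}C]$ with $\delta\in\mathbb E(C,A)$ is called an $\mathfrak s$-triangle $A\xrightarrow{f}B\xrightarrow{g}C\overset{\delta}{\dashrightarrow}$. An object $P$ is projective if $\mathbb E(P,X)=0$ for all $X\in\mathcal C$. Assume that $\mathcal C$ has enough projective objects, i.e. for each $C\in\mathcal C$ there is an $\mathfrak s$-triangle $A\to P\to C\dashrightarrow$ with $P$ projective. Let $\operatorname{mod}\mathcal C$ be the category of finitely presented right $\mathcal C$-modules, i.e. additive functors $M\colon\mathcal C^{\mathrm{op}}\to\mathrm{Ab}$ admitting an exact sequence $\mathcal C(-,B)\to\mathcal C(-,C)\to M\to 0$, and let $Y_{\mathcal C}\colon\mathcal C\to\operatorname{mod}\mathcal C$, $X\mapsto\mathcal C(-,X)$, be the Yoneda embedding. For $\delta\in\mathbb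 E(C,A)$ let $\delta^{\ast}$ be the image of $\delta_\sharp\colon\mathcal C(-,C)\to\mathbb E(-,A)$, $c\mapsto\mathbb E(c,A)(\delta)$, and let $\operatorname{def}\mathbb E\subseteq\operatorname{mod}\mathcal C$ be the full subcategory of modules isomorphic to some $\delta^\ast$. An additive functor $H\colon\mathcal C\to\mathcal A$ to an abelian category is half exact if $HA\xrightarrow{Hf}HB\xrightarrow{Hg}HC$ is exact at $HB$ for each $\mathfrak s$-triangle $A\xrightarrow{f}B\xrightarrow{g}C\dashrightarrow$. A projectivization functor is a half exact functor of the form $Q\circ\Gamma\circ Y_{\mathcal C}$, where $\Gamma$ is a left adjoint of the inclusion $\operatorname{def}\mathbb E\hookrightarrow\operatorname{mod}\mathcal C$ and $Q\colon\operatorname{def}\mathbb E\to(\operatorname{def}\mathbb E)/\mathcal S$ is the Serre quotient functor for a Serre subcategory $\mathcal S$ of the abelian category $\operatorname{def}\mathbb E$. (That $\operatorname{def}\mathbb E$ is abelian and that $\Gamma$ exists is part of the claim.) For half exact functors $H\colon\mathcal C\to\mathcal A$ and $G\colon\mathcal C\to\mathcal B$, we say that $H$ is a faithfully exact reduction of $G$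 if there is a faithful exact functor $F\colon\mathcal B\to\mathcal A$ with $H\cong F\circ G$. Let $H\colon\mathcal C\to\mathcal A$ be a half exact functor to an abelian category with $H(P)=0$ for every projective object $P$. Then $H\cong F\circ(Q\circ\Gamma\circ Y_{\mathcal C})$ for some projectivization functor $Q\circ\Gamma\circ Y_{\mathcal C}$ and some faithful exact functor $F$; that is, $H$ is a faithfully exact reduction of a projectivization functor. -/

import Mathlib

open CategoryTheory CategoryTheory.Limits Opposite

universe v u v₁ u₁ v₂ u₂

noncomputable section

namespace Extri

/-! ### Extensions: elements of the values of a biadditive functor `Cᵒᵖ ⥤ C ⥤ Ab` -/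

section Extensions

variable {C : Type u} [Category.{v} C] (E : Cᵒᵖ ⥤ C ⥤ AddCommGrpCat.{v})

/-- The group `𝔼(Z, X)` of extensions of `Z` by `X`. -/
abbrev Extension (Z X : C) : Type v := (E.obj (op Z)).obj X

variable {E}

/-- The push-forward `a δ = 𝔼(Z, a)(δ)`. -/
def push {Z X X' : C} (a : X ⟶ X') (δ : Extension E Z X) : Extension E Z X' :=
  (E.obj (op Z)).map a δ

/-- The pull-back `δ c = 𝔼(c, X)(δ)`. -/
def pull {Z Z' X : C} (c : Z' ⟶ Z) (δ : Extension E Z X) : Extension E Z' X :=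
  (E.map c.op).app X δ

theorem pull_comp {Z Z' Z'' X : C} (c' : Z'' ⟶ Z') (c : Z' ⟶ Z) (δ : Extension E Z X) :
    pull (c' ≫ c) δ = pull c' (pull c δ) := by
  simp only [pull, op_comp, Functor.map_comp]
  rfl

theorem push_zero {Z X X' : C} (a : X ⟶ X') : push a (0 : Extension E Z X) = 0 :=
  map_zero ((E.obj (op Z)).map a).hom

theorem zero_pull [Preadditive C] (hE : E.Additive) {Z Z' X : C} (δ : Extension E Z X) :
    pull (0 : Z' ⟶ Z) δ = 0 := by
  simp only [pull, op_zero, Functor.map_zero]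
  rfl

theorem add_pull [Preadditive C] (hE : E.Additive) {Z Z' X : C} (c d : Z' ⟶ Z)
    (δ : Extension E Z X) : pull (c + d) δ = pull c δ + pull d δ := by
  simp only [pull, op_add, Functor.map_add]
  rfl

/-- The direct sum `δ ⊕ δ'`, with components `(δ, 0, 0, δ')`. -/
def directSum [Preadditive C] [HasBinaryBiproducts C] {Z X Z' X' : C}
    (δ : Extension E Z X) (δ' : Extension E Z' X') : Extension E (Z ⊞ Z') (X ⊞ X') :=
  push (biprod.inl : X ⟶ X ⊞ X') (pull (biprod.fst : Z ⊞ Z' ⟶ Z) δ) +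
    push (biprod.inr : X' ⟶ X ⊞ X') (pull (biprod.snd : Z ⊞ Z' ⟶ Z') δ')

end Extensions

/-! ### Equivalence classes of sequences `X ⟶ Y ⟶ Z` -/

section Sequences

variable {C : Type u} [Category.{v} C]

/-- A sequence of morphisms `X ⟶ Y ⟶ Z` with fixed ends. -/
structure Sequence (X Z : C) where
  /-- the middle object -/
  mid : C
  /-- the first morphism -/
  f : X ⟶ mid
  /-- the second morphism -/
  g : mid ⟶ Z

/-- Two sequences with the same ends are equivalent if there is an isomorphism of the middle
objects compatible with the morphisms. -/
def Sequence.setoid (X Z : C) : Setoid (Sequence X Z) where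
  r S T := ∃ b : S.mid ≅ T.mid, S.f ≫ b.hom = T.f ∧ b.hom ≫ T.g = S.g
  iseqv :=
    { refl := fun S => ⟨Iso.refl _, by simp, by simp⟩
      symm := by
        rintro S T ⟨b, h₁, h₂⟩
        exact ⟨b.symm, by simp [← h₁], by simp [← h₂]⟩
      trans := by
        rintro S T U ⟨b, h₁, h₂⟩ ⟨c, h₃, h₄⟩
        exact ⟨b ≪≫ c, by simp [← h₃, ← h₁], by simp [h₄, h₂]⟩ }

/-- Equivalence classes of sequences `X ⟶ Y ⟶ Z`. -/
def SequenceClass (X Z : C) : Type (max u v) := Quotient (Sequence.setoid X Z)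

/-- The equivalence class `[X ⟶ Y ⟶ Z]`. -/
def seqClass {X Y Z : C} (f : X ⟶ Y) (g : Y ⟶ Z) : SequenceClass X Z :=
  Quotient.mk (Sequence.setoid X Z) ⟨Y, f, g⟩

end Sequences

/-! ### Extriangulated categories -/

/-- An extriangulated structure `(𝔼, 𝔰)` on an additive category `C`.  An equation
`s δ = seqClass f g` says that `X --f--> Y --g--> Z --δ-->` is an `𝔰`-triangle. -/
structure ExtriangulatedStructure (C : Type u) [Category.{v} C] [Preadditive C]
    [HasZeroObject C] [HasBinaryBiproducts C] where
  /-- the bifunctor `𝔼` -/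
  E : Cᵒᵖ ⥤ C ⥤ AddCommGrpCat.{v}
  additive_left : E.Additive
  additive_right : ∀ Z : Cᵒᵖ, (E.obj Z).Additive
  /-- the realization `𝔰` -/
  s : ∀ {Z X : C}, Extension E Z X → SequenceClass X Z
  /-- A morphism of extensions induces a morphism of `𝔰`-triangles. -/
  exists_mid : ∀ {X Y Z X' Y' Z' : C} (f : X ⟶ Y) (g : Y ⟶ Z) (δ : Extension E Z X)
    (f' : X' ⟶ Y') (g' : Y' ⟶ Z') (δ' : Extension E Z' X'),
    s δ = seqClass f g → s δ' = seqClass f' g' →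
    ∀ (a : X ⟶ X') (c : Z ⟶ Z'), push a δ = pull c δ' →
      ∃ b : Y ⟶ Y', f ≫ b = a ≫ f' ∧ g ≫ c = b ≫ g'
  /-- Split extensions are realized by split sequences. -/
  s_zero : ∀ Z X : C, s (0 : Extension E Z X) =
    seqClass (biprod.inl : X ⟶ X ⊞ Z) (biprod.snd : X ⊞ Z ⟶ Z)
  /-- The realization is compatible with direct sums. -/
  s_directSum : ∀ {X Y Z X' Y' Z' : C} (f : X ⟶ Y) (g : Y ⟶ Z) (δ : Extension E Z X)
    (f' : X' ⟶ Y') (g' : Y' ⟶ Z') (δ' : Extension E Z' X'),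
    s δ = seqClass f g → s δ' = seqClass f' g' →
      s (directSum δ δ') = seqClass (biprod.map f f') (biprod.map g g')
  /-- (ET3) -/
  et3 : ∀ {X Y Z X' Y' Z' : C} (f : X ⟶ Y) (g : Y ⟶ Z) (δ : Extension E Z X)
    (f' : X' ⟶ Y') (g' : Y' ⟶ Z') (δ' : Extension E Z' X'),
    s δ = seqClass f g → s δ' = seqClass f' g' →
    ∀ (a : X ⟶ X') (b : Y ⟶ Y'), f ≫ b = a ≫ f' →
      ∃ c : Z ⟶ Z', g ≫ c = b ≫ g' ∧ push a δ = pull c δ'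
  /-- (ET3)ᵒᵖ -/
  et3_op : ∀ {X Y Z X' Y' Z' : C} (f : X ⟶ Y) (g : Y ⟶ Z) (δ : Extension E Z X)
    (f' : X' ⟶ Y') (g' : Y' ⟶ Z') (δ' : Extension E Z' X'),
    s δ = seqClass f g → s δ' = seqClass f' g' →
    ∀ (b : Y ⟶ Y') (c : Z ⟶ Z'), g ≫ c = b ≫ g' →
      ∃ a : X ⟶ X', f ≫ b = a ≫ f' ∧ push a δ = pull c δ'
  /-- (ET4): for `𝔰`-triangles `X --f--> Y --f'--> W --δ-->` and `Y --g--> Z --g'--> V --ρ-->`. -/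
  et4 : ∀ {X Y Z W V : C} (f : X ⟶ Y) (f' : Y ⟶ W) (δ : Extension E W X)
    (g : Y ⟶ Z) (g' : Z ⟶ V) (ρ : Extension E V Y),
    s δ = seqClass f f' → s ρ = seqClass g g' →
    ∃ (U : C) (h' : Z ⟶ U) (d : W ⟶ U) (e : U ⟶ V) (δ' : Extension E U X),
      s δ' = seqClass (f ≫ g) h' ∧ s (push f' ρ) = seqClass d e ∧
      f' ≫ d = g ≫ h' ∧ h' ≫ e = g' ∧
      pull d δ' = δ ∧ pull e ρ = push f δ'
  /-- (ET4)ᵒᵖ: for `𝔰`-triangles `W --f'--> X --f--> Y --δ-->` and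
  `V --g'--> Y --g--> Z --ρ-->`. -/
  et4_op : ∀ {X Y Z W V : C} (f' : W ⟶ X) (f : X ⟶ Y) (δ : Extension E Y W)
    (g' : V ⟶ Y) (g : Y ⟶ Z) (ρ : Extension E Z V),
    s δ = seqClass f' f → s ρ = seqClass g' g →
    ∃ (U : C) (h' : U ⟶ X) (d : W ⟶ U) (e : U ⟶ V) (δ' : Extension E Z U),
      s δ' = seqClass h' (f ≫ g) ∧ s (pull g' δ) = seqClass d e ∧
      h' ≫ f = e ≫ g' ∧ d ≫ h' = f' ∧
      push e δ' = ρ ∧ push d δ = pull g δ'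

namespace ExtriangulatedStructure

variable {C : Type u} [Category.{v} C] [Preadditive C] [HasZeroObject C] [HasBinaryBiproducts C]
  (𝓔 : ExtriangulatedStructure C)

/-- `X --f--> Y --g--> Z --δ-->` is an `𝔰`-triangle. -/
def IsTriangle {X Y Z : C} (f : X ⟶ Y) (g : Y ⟶ Z) (δ : Extension 𝓔.E Z X) : Prop :=
  𝓔.s δ = seqClass f g

/-- An object `P` is projective if `𝔼(P, X) = 0` for all `X`. -/
def IsProjective (P : C) : Prop := ∀ (X : C) (δ : Extension 𝓔.E P X), δ = 0

/-- There are enough projective objects. -/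
def HasEnoughProjectives : Prop :=
  ∀ Z : C, ∃ (X P : C) (f : X ⟶ P) (g : P ⟶ Z) (δ : Extension 𝓔.E Z X),
    𝓔.IsProjective P ∧ 𝓔.IsTriangle f g δ

/-- An additive functor to an abelian category is half exact if it sends every `𝔰`-triangle
`X ⟶ Y ⟶ Z ⇢` to a sequence that is exact at the middle term. -/
structure IsHalfExact {A : Type u₁} [Category.{v₁} A] [Abelian A] (H : C ⥤ A) : Prop where
  additive : H.Additive
  exact : ∀ {X Y Z : C} (f : X ⟶ Y) (g : Y ⟶ Z) (δ : Extension 𝓔.E Z X), 𝓔.IsTriangle f g δ →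
    ∃ w : H.map f ≫ H.map g = 0, (ShortComplex.mk (H.map f) (H.map g) w).Exact

end ExtriangulatedStructure

/-! ### Finitely presented modules and defects -/

theorem epi_factorThruImage {C : Type u} [Category.{v} C] {M N : Cᵒᵖ ⥤ AddCommGrpCat.{v}}
    (f : M ⟶ N) : Epi (Abelian.factorThruImage f) := inferInstance

section Modules

variable {C : Type u} [Category.{v} C] [Preadditive C]

/-- Finitely presented right `C`-modules: additive functors `M : Cᵒᵖ ⥤ Ab` with an exact
sequence `C(-, Y) ⟶ C(-, Z) ⟶ M ⟶ 0`. -/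
def isFinitelyPresented : ObjectProperty (Cᵒᵖ ⥤ AddCommGrpCat.{v}) := fun M =>
  M.Additive ∧
    ∃ (Y Z : C) (φ : preadditiveYoneda.obj Y ⟶ preadditiveYoneda.obj Z)
      (π : preadditiveYoneda.obj Z ⟶ M) (w : φ ≫ π = 0),
      (ShortComplex.mk φ π w).Exact ∧ Epi π

variable (C) in
/-- The category `mod C` of finitely presented right `C`-modules. -/
abbrev FPMod : Type (max u (v + 1)) := (isFinitelyPresented (C := C)).FullSubcategory

theorem isFinitelyPresented_yoneda (X : C) :
    isFinitelyPresented (preadditiveYoneda.obj X) := by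
  refine ⟨inferInstance, X, X, 0, 𝟙 _, by simp, ?_, inferInstance⟩
  exact (ShortComplex.exact_iff_mono _ rfl).2 (inferInstanceAs (Mono (𝟙 _)))

variable (C) in
/-- The Yoneda embedding `C ⥤ mod C`, `X ↦ C(-, X)`. -/
def yonedaMod : C ⥤ FPMod C :=
  isFinitelyPresented.lift preadditiveYoneda isFinitelyPresented_yoneda

end Modules

namespace ExtriangulatedStructure

variable {C : Type u} [Category.{v} C] [Preadditive C] [HasZeroObject C] [HasBinaryBiproducts C]
  (𝓔 : ExtriangulatedStructure C)

/-- The morphism `δ♯ : C(-, Z) ⟶ 𝔼(-, X)`, `c ↦ δ c`. -/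
def sharp {Z X : C} (δ : Extension 𝓔.E Z X) :
    preadditiveYoneda.obj Z ⟶ 𝓔.E.flip.obj X where
  app W := AddCommGrpCat.ofHom
    { toFun := fun c : W.unop ⟶ Z => (pull c δ : Extension 𝓔.E W.unop X)
      map_zero' := zero_pull 𝓔.additive_left δ
      map_add' := fun c d => add_pull 𝓔.additive_left c d δ }
  naturality W W' h := by
    ext c
    exact pull_comp h.unop c δ

/-- The contravariant defect of `δ`: the image of `δ♯` in the category of modules. -/
def defect {Z X : C} (δ : Extension 𝓔.E Z X) : Cᵒᵖ ⥤ AddCommGrpCat.{v} :=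
  Abelian.image (𝓔.sharp δ)

/-- The modules isomorphic to contravariant defects of extensions. -/
def isDefect : ObjectProperty (Cᵒᵖ ⥤ AddCommGrpCat.{v}) := fun M =>
  ∃ (Z X : C) (δ : Extension 𝓔.E Z X), Nonempty (M ≅ 𝓔.defect δ)

/-- The category `def 𝔼` of defects, a full subcategory of the category of modules. -/
abbrev Def : Type (max u (v + 1)) := 𝓔.isDefect.FullSubcategory

theorem exists_eq_comp_of_pull_eq_zero {X Y Z : C} {f : X ⟶ Y} {g : Y ⟶ Z}
    {δ : Extension 𝓔.E Z X} (h : 𝓔.IsTriangle f g δ) {W : C} (c : W ⟶ Z)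
    (hc : pull c δ = 0) : ∃ b : W ⟶ Y, b ≫ g = c := by
  obtain ⟨b, -, hb⟩ := 𝓔.exists_mid _ _ _ f g δ (𝓔.s_zero W X) h (𝟙 X) c
    (by rw [hc, push_zero])
  exact ⟨biprod.inr ≫ b, by rw [Category.assoc, ← hb, biprod.inr_snd_assoc]⟩

theorem pull_eq_zero {X Y Z : C} {f : X ⟶ Y} {g : Y ⟶ Z}
    {δ : Extension 𝓔.E Z X} (h : 𝓔.IsTriangle f g δ) : pull g δ = 0 := by
  obtain ⟨a, -, ha⟩ := 𝓔.et3_op _ _ _ f g δ (𝓔.s_zero Y X) h biprod.snd g rfl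
  rw [← ha, push_zero]

theorem isFinitelyPresented_defect {Z X : C} (δ : Extension 𝓔.E Z X) :
    isFinitelyPresented (𝓔.defect δ) := by
  have := 𝓔.additive_left
  constructor
  · refine ⟨fun {U V c d} => ?_⟩
    unfold defect
    rw [← cancel_mono ((Abelian.image.ι (𝓔.sharp δ)).app V)]
    have h (e : U ⟶ V) := (Abelian.image.ι (𝓔.sharp δ)).naturality e
    have h' : (𝓔.E.flip.obj X).map (c + d) =
        (𝓔.E.flip.obj X).map c + (𝓔.E.flip.obj X).map d := by
      simp [Functor.map_add]
    rw [Preadditive.add_comp, h, h, h, h', Preadditive.comp_add]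
  · obtain ⟨⟨Y, f, g⟩, h⟩ := Quotient.exists_rep (𝓔.s δ)
    have h : 𝓔.IsTriangle f g δ := h.symm
    have w : preadditiveYoneda.map g ≫ 𝓔.sharp δ = 0 := by
      ext W c
      refine (pull_comp (E := 𝓔.E) (c : W.unop ⟶ Y) g δ).trans ?_
      rw [𝓔.pull_eq_zero h]
      exact map_zero ((𝓔.E.map (Quiver.Hom.op (c : W.unop ⟶ Y))).app X).hom
    have w' : preadditiveYoneda.map g ≫ Abelian.factorThruImage (𝓔.sharp δ) = 0 := by
      rw [← cancel_mono (Abelian.image.ι (𝓔.sharp δ)), Category.assoc, Abelian.image.fac, w,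
        zero_comp]
    refine ⟨Y, Z, preadditiveYoneda.map g, Abelian.factorThruImage (𝓔.sharp δ), w', ?_,
      epi_factorThruImage _⟩
    let φ : ShortComplex.mk _ _ w' ⟶ ShortComplex.mk _ _ w :=
      { τ₁ := 𝟙 _, τ₂ := 𝟙 _, τ₃ := Abelian.image.ι (𝓔.sharp δ) }
    have : Epi φ.τ₁ := inferInstanceAs (Epi (𝟙 _))
    have : IsIso φ.τ₂ := inferInstanceAs (IsIso (𝟙 _))
    have : Mono φ.τ₃ := inferInstanceAs (Mono (Abelian.image.ι (𝓔.sharp δ)))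
    refine (ShortComplex.exact_iff_of_epi_of_isIso_of_mono φ).2 ?_
    rw [ShortComplex.exact_iff_isZero_homology, Functor.isZero_iff]
    intro W
    refine IsZero.of_iso ?_
      (ShortComplex.mapHomologyIso _ ((evaluation Cᵒᵖ AddCommGrpCat.{v}).obj W)).symm
    rw [← ShortComplex.exact_iff_isZero_homology, ShortComplex.ab_exact_iff]
    intro c hc
    exact 𝓔.exists_eq_comp_of_pull_eq_zero h c hc

theorem isDefect_le : 𝓔.isDefect ≤ isFinitelyPresented (C := C) := by
  rintro M ⟨Z, X, δ, ⟨e⟩⟩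
  obtain ⟨hadd, Y, Z', φ, π, w, hex, hepi⟩ := 𝓔.isFinitelyPresented_defect δ
  refine ⟨Functor.additive_of_iso e.symm, Y, Z', φ, π ≫ e.inv, by rw [reassoc_of% w, zero_comp],
    ?_, inferInstance⟩
  refine ShortComplex.exact_of_iso (S₁ := ShortComplex.mk φ π w) (ShortComplex.isoMk (Iso.refl _) (Iso.refl _) e.symm ?_ ?_) hex
  all_goals simp

/-- The inclusion `ι : def 𝔼 ⥤ mod C`. -/
def incl : 𝓔.Def ⥤ FPMod C := ObjectProperty.ιOfLE 𝓔.isDefect_le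

/-! ### Projectivization functors -/

/-- A functor `G : C ⥤ B` to an abelian category is a projectivization functor if it is half
exact and of the form `Q ∘ Γ ∘ Y`, where `Y : C ⥤ mod C` is the Yoneda embedding, `Γ` is a left
adjoint of the inclusion `def 𝔼 ⥤ mod C`, and `Q` is a Serre quotient functor of the abelian
category `def 𝔼`, i.e. a localization at the morphisms whose kernel and cokernel lie in some Serre
subcategory `S`.  (`Abelian` is a property here: a category with finite biproducts has only one
preadditive structure.) -/
def IsProjectivizationFunctor {B : Type u₁} [Category.{v₁} B] [Abelian B] (G : C ⥤ B) : Prop :=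
  𝓔.IsHalfExact G ∧
    ∃ (_ : Abelian 𝓔.Def) (Γ : FPMod C ⥤ 𝓔.Def) (_ : Nonempty (Γ ⊣ 𝓔.incl))
      (S : ObjectProperty 𝓔.Def) (_ : S.IsSerreClass) (Q : 𝓔.Def ⥤ B),
      Q.IsLocalization S.isoModSerre ∧ G = yonedaMod C ⋙ Γ ⋙ Q

end ExtriangulatedStructure

/-- `H'` is a faithfully exact reduction of `H` if `H' ≅ F ∘ H` for some faithful exact
functor `F`. -/
def IsFaithfullyExactReduction {C : Type u} [Category.{v} C]
    {A : Type u₁} [Category.{v₁} A] [Abelian A] {A' : Type u₂} [Category.{v₂} A'] [Abelian A']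
    (H' : C ⥤ A') (H : C ⥤ A) : Prop :=
  ∃ F : A ⥤ A', F.Faithful ∧ F.Additive ∧ PreservesFiniteLimits F ∧
    PreservesFiniteColimits F ∧ Nonempty (H' ≅ H ⋙ F)

end Extri

end

/-! Defects are exactly the modules with one generator whose annihilator is the image of a deflation
`g`, that is, the cokernels of `C(-, Y) ⟶ C(-, Z)` with `g : Y ⟶ Z` a deflation. Annihilators of
arbitrary elements of a defect are again images of deflations (`exists_isDeflation_annihilator`),
and `(p, g)` is a deflation as soon as `p` is (`IsDeflation.biprod_desc`). So kernels and cokernels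
taken in the functor category stay among the defects, and `def 𝔼` is abelian with exact inclusion.

Defects vanish on projectives. Reflecting a module presented by `g : Y ⟶ Z` therefore amounts to
adding the relations coming from a deflation `p : P ⟶ Z` with `P` projective; in particular `Γ(C(-,
X))` is presented by `p : P ⟶ X` (`isPresentedBy_unitElement`).

The functor `H` extends to `def 𝔼` by sending the module presented by `g` to `coker (H g)`. Half
exactness of `H` makes this extension exact (`IsHalfExact.map_extendDef_shortExact`). Its value on
`Γ(C(-, X))` is `coker (H P ⟶ H X)`, which is `H X` because `H P = 0` (`isIso_ev_unitElement`). The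
kernel `S` of the extension is a Serre subcategory, and the functor induced on the quotient by `S`
is exact and reflects zero objects, hence is faithful. Being faithful and exact, it also reflects
exactness, so `Q ∘ Γ ∘ Y` inherits half exactness from `H`. -/

noncomputable section

namespace Extri

/-! ### Modules with one generator and relations given by one morphism -/

section Presentations

variable {C : Type u} [Category.{v} C]

/-- The element `z` generates the module `M`, and its annihilator consists of the morphisms that
factor through `g`. -/
structure IsPresentedBy (M : Cᵒᵖ ⥤ AddCommGrpCat.{v}) {Y Z : C} (g : Y ⟶ Z)
    (z : M.obj (op Z)) : Prop where
  exists_map_eq : ∀ {W : C} (m : M.obj (op W)), ∃ c : W ⟶ Z, M.map c.op z = m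
  map_eq_zero_iff : ∀ {W : C} (c : W ⟶ Z), M.map c.op z = 0 ↔ ∃ b : W ⟶ Y, b ≫ g = c

theorem map_op_comp (M : Cᵒᵖ ⥤ AddCommGrpCat.{v}) {W X Z : C} (c : W ⟶ X) (d : X ⟶ Z)
    (z : M.obj (op Z)) : M.map (c ≫ d).op z = M.map c.op (M.map d.op z) := by
  simp

theorem map_op_app {M N : Cᵒᵖ ⥤ AddCommGrpCat.{v}} (φ : M ⟶ N) {W Z : C} (c : W ⟶ Z)
    (z : M.obj (op Z)) : φ.app (op W) (M.map c.op z) = N.map c.op (φ.app (op Z) z) :=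
  NatTrans.naturality_apply φ c.op z

theorem map_op_add [Preadditive C] (M : Cᵒᵖ ⥤ AddCommGrpCat.{v}) [M.Additive] {W Z : C}
    (c d : W ⟶ Z) (z : M.obj (op Z)) :
    M.map (c + d).op z = M.map c.op z + M.map d.op z := by
  simp [op_add, Functor.map_add]

theorem map_op_sub [Preadditive C] (M : Cᵒᵖ ⥤ AddCommGrpCat.{v}) [M.Additive] {W Z : C}
    (c d : W ⟶ Z) (z : M.obj (op Z)) :
    M.map (c - d).op z = M.map c.op z - M.map d.op z := by
  rw [eq_sub_iff_add_eq, ← map_op_add, sub_add_cancel]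

theorem map_op_zero [Preadditive C] (M : Cᵒᵖ ⥤ AddCommGrpCat.{v}) [M.Additive] {W Z : C}
    (z : M.obj (op Z)) : M.map (0 : W ⟶ Z).op z = 0 := by
  simp [op_zero, Functor.map_zero]

namespace IsPresentedBy

variable {M N : Cᵒᵖ ⥤ AddCommGrpCat.{v}} {Y Y' Z Z' : C} {g : Y ⟶ Z} {g' : Y' ⟶ Z}
  {z : M.obj (op Z)} {n : N.obj (op Z)}

theorem map_eq_zero (h : IsPresentedBy M g z) : M.map g.op z = 0 :=
  (h.map_eq_zero_iff g).2 ⟨𝟙 _, Category.id_comp _⟩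

theorem hom_ext (h : IsPresentedBy M g z) {φ ψ : M ⟶ N}
    (e : φ.app (op Z) z = ψ.app (op Z) z) : φ = ψ := by
  ext ⟨W⟩ m
  obtain ⟨c, rfl⟩ := h.exists_map_eq m
  rw [map_op_app, map_op_app, e]

/-- An element that satisfies the relations of a presentation is the image of the generator under
a morphism. -/
theorem exists_hom [Preadditive C] [M.Additive] [N.Additive] (h : IsPresentedBy M g z)
    (hn : N.map g.op n = 0) : ∃ φ : M ⟶ N, φ.app (op Z) z = n := by
  -- Well-definedness: morphisms with the same action on `z` differ by one that factors through `g`,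
  -- and `g` kills `n`.
  have key {W : C} (c d : W ⟶ Z) (e : M.map c.op z = M.map d.op z) :
      N.map c.op n = N.map d.op n := by
    obtain ⟨b, hb⟩ := (h.map_eq_zero_iff (c - d)).1 (by rw [map_op_sub, e, sub_self])
    rw [← sub_eq_zero, ← map_op_sub, ← hb, map_op_comp, hn, map_zero]
  let l {W : C} (m : M.obj (op W)) : W ⟶ Z := (h.exists_map_eq m).choose
  have hl {W : C} (m : M.obj (op W)) : M.map (l m).op z = m := (h.exists_map_eq m).choose_spec
  refine ⟨{ app := fun W => AddCommGrpCat.ofHom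
              { toFun := fun m : M.obj (op W.unop) => N.map (l m).op n
                map_zero' := ?_
                map_add' := ?_ }
            naturality := ?_ }, ?_⟩
  · rw [key (l 0) 0 (by rw [hl, map_op_zero]), map_op_zero]
  · intro m m'
    rw [key (l (m + m')) (l m + l m') (by rw [map_op_add, hl, hl, hl]), map_op_add]
  · rintro ⟨W⟩ ⟨W'⟩ c
    ext m
    refine (key _ (c.unop ≫ l m) ?_).trans (map_op_comp N c.unop (l m) n)
    rw [map_op_comp, hl, hl]
    rfl
  · refine (key (l z) (𝟙 Z) ?_).trans ?_
    · rw [hl]; simp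
    · simp

theorem exists_iso [Preadditive C] [M.Additive] [N.Additive] (h : IsPresentedBy M g z)
    (h' : IsPresentedBy N g' n) (hn : N.map g.op n = 0) (hz : M.map g'.op z = 0) :
    ∃ e : M ≅ N, e.hom.app (op Z) z = n := by
  obtain ⟨φ, hφ⟩ := h.exists_hom hn
  obtain ⟨ψ, hψ⟩ := h'.exists_hom hz
  exact ⟨⟨φ, ψ, h.hom_ext (by simp [hφ, hψ]), h'.hom_ext (by simp [hφ, hψ])⟩, hφ⟩

theorem of_iso (h : IsPresentedBy M g z) (e : M ≅ N) :
    IsPresentedBy N g (e.hom.app (op Z) z) where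
  exists_map_eq {W} m := by
    obtain ⟨c, hc⟩ := h.exists_map_eq (e.inv.app (op W) m)
    exact ⟨c, by rw [← map_op_app, hc]; simp⟩
  map_eq_zero_iff {W} c := by
    rw [← h.map_eq_zero_iff, ← map_op_app]
    refine ⟨fun hc => ?_, fun hc => by rw [hc, map_zero]⟩
    simpa using congrArg (e.inv.app (op W)) hc

end IsPresentedBy

theorem app_surjective {M N : Cᵒᵖ ⥤ AddCommGrpCat.{v}} (φ : M ⟶ N) [Epi φ] (W : Cᵒᵖ) :
    Function.Surjective (φ.app W) :=
  (AddCommGrpCat.epi_iff_surjective _).1 inferInstance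

theorem app_injective {M N : Cᵒᵖ ⥤ AddCommGrpCat.{v}} (φ : M ⟶ N) [Mono φ] (W : Cᵒᵖ) :
    Function.Injective (φ.app W) :=
  (AddCommGrpCat.mono_iff_injective _).1 inferInstance

theorem app_exact {S : ShortComplex (Cᵒᵖ ⥤ AddCommGrpCat.{v})} (hS : S.Exact) {W : Cᵒᵖ}
    (m : S.X₂.obj W) (hm : S.g.app W m = 0) : ∃ l, S.f.app W l = m :=
  (ShortComplex.ab_exact_iff _).1 (hS.map ((evaluation Cᵒᵖ AddCommGrpCat.{v}).obj W)) m hm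

/-- The element of `M` that corresponds to a morphism from a representable functor. -/
def yonedaElement [Preadditive C] {M : Cᵒᵖ ⥤ AddCommGrpCat.{v}} {Z : C}
    (π : preadditiveYoneda.obj Z ⟶ M) : M.obj (op Z) := π.app (op Z) (𝟙 Z : Z ⟶ Z)

theorem preadditiveYoneda_app [Preadditive C] {M : Cᵒᵖ ⥤ AddCommGrpCat.{v}} {Z W : C}
    (π : preadditiveYoneda.obj Z ⟶ M) (c : W ⟶ Z) :
    π.app (op W) c = M.map c.op (yonedaElement π) := by
  refine Eq.trans ?_ (map_op_app π c (𝟙 Z : Z ⟶ Z))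
  congr 1
  exact (Category.comp_id c).symm

theorem isFinitelyPresented_exists [Preadditive C] {M : Cᵒᵖ ⥤ AddCommGrpCat.{v}}
    (hM : isFinitelyPresented M) :
    ∃ (Y Z : C) (g : Y ⟶ Z) (z : M.obj (op Z)), IsPresentedBy M g z := by
  obtain ⟨-, Y, Z, φ, π, w, hex, _⟩ := hM
  refine ⟨Y, Z, yonedaElement φ, yonedaElement π, ⟨fun {W} m => ?_,
    fun {W} c => ?_⟩⟩
  · obtain ⟨c, hc⟩ := app_surjective π (op W) m
    exact ⟨c, (preadditiveYoneda_app π c).symm.trans hc⟩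
  · rw [← preadditiveYoneda_app π c]
    constructor
    · intro hc
      obtain ⟨b, hb⟩ := app_exact hex c hc
      exact ⟨b, (preadditiveYoneda_app φ b).symm.trans hb⟩
    · rintro ⟨b, rfl⟩
      refine Eq.trans ?_ (congrArg (fun ψ => ψ.app (op W) b) w)
      exact congrArg (π.app (op W)) (preadditiveYoneda_app φ b).symm

end Presentations

/-! ### Defects as modules presented by deflations -/

namespace ExtriangulatedStructure

variable {C : Type u} [Category.{v} C] [Preadditive C] [HasZeroObject C] [HasBinaryBiproducts C]
  (𝓔 : ExtriangulatedStructure C)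

theorem exists_triangle {Z X : C} (δ : Extension 𝓔.E Z X) :
    ∃ (Y : C) (f : X ⟶ Y) (g : Y ⟶ Z), 𝓔.IsTriangle f g δ := by
  obtain ⟨⟨Y, f, g⟩, h⟩ := Quotient.exists_rep (𝓔.s δ)
  exact ⟨Y, f, g, h.symm⟩

variable {𝓔} in
theorem IsTriangle.pull_eq_zero_iff {X Y Z : C} {f : X ⟶ Y} {g : Y ⟶ Z}
    {δ : Extension 𝓔.E Z X} (h : 𝓔.IsTriangle f g δ) {W : C} (c : W ⟶ Z) :
    pull c δ = 0 ↔ ∃ b : W ⟶ Y, b ≫ g = c := by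
  refine ⟨𝓔.exists_eq_comp_of_pull_eq_zero h c, ?_⟩
  rintro ⟨b, rfl⟩
  rw [pull_comp, 𝓔.pull_eq_zero h]
  exact map_zero ((𝓔.E.map b.op).app X).hom

/-- The canonical generator of the defect of `δ`. -/
def defectGenerator {Z X : C} (δ : Extension 𝓔.E Z X) : (𝓔.defect δ).obj (op Z) :=
  yonedaElement (Abelian.factorThruImage (𝓔.sharp δ))

theorem image_ι_map_defectGenerator {Z X : C} (δ : Extension 𝓔.E Z X) {W : C} (c : W ⟶ Z) :
    (Abelian.image.ι (𝓔.sharp δ)).app (op W) ((𝓔.defect δ).map c.op (𝓔.defectGenerator δ)) =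
      (pull c δ : Extension 𝓔.E W X) := by
  have h : (𝓔.defect δ).map c.op (𝓔.defectGenerator δ) =
      (Abelian.factorThruImage (𝓔.sharp δ)).app (op W) c :=
    (preadditiveYoneda_app (Abelian.factorThruImage (𝓔.sharp δ)) c).symm
  rw [h]
  exact congrArg (fun ψ => ψ.app (op W) c) (Abelian.image.fac (𝓔.sharp δ))

variable {𝓔} in
-- The image of `δ♯` is generated by the class of the identity, and the kernel of `δ♯` consists of
-- the morphisms through `g` by exactness of the triangle.
theorem IsTriangle.isPresentedBy_defect {X Y Z : C} {f : X ⟶ Y} {g : Y ⟶ Z}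
    {δ : Extension 𝓔.E Z X} (h : 𝓔.IsTriangle f g δ) :
    IsPresentedBy (𝓔.defect δ) g (𝓔.defectGenerator δ) where
  exists_map_eq {W} m := by
    obtain ⟨c, rfl⟩ := app_surjective (Abelian.factorThruImage (𝓔.sharp δ)) (op W) m
    exact ⟨c, (preadditiveYoneda_app (Abelian.factorThruImage (𝓔.sharp δ)) c).symm⟩
  map_eq_zero_iff {W} c := by
    rw [← h.pull_eq_zero_iff, ← 𝓔.image_ι_map_defectGenerator]
    exact (map_eq_zero_iff _ (app_injective (Abelian.image.ι (𝓔.sharp δ)) (op W))).symm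

theorem additive_defect {Z X : C} (δ : Extension 𝓔.E Z X) : (𝓔.defect δ).Additive :=
  (𝓔.isFinitelyPresented_defect δ).1

theorem additive_of_isDefect {M : Cᵒᵖ ⥤ AddCommGrpCat.{v}} (hM : 𝓔.isDefect M) : M.Additive :=
  (𝓔.isDefect_le _ hM).1

instance (M : 𝓔.Def) : M.obj.Additive := 𝓔.additive_of_isDefect M.property

/-- A deflation is the second morphism of an `𝔰`-triangle. -/
def IsDeflation {Y Z : C} (g : Y ⟶ Z) : Prop :=
  ∃ (X : C) (f : X ⟶ Y) (δ : Extension 𝓔.E Z X), 𝓔.IsTriangle f g δ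

variable {𝓔} in
-- A presentation determines the module up to isomorphism, so it suffices to compare with the defect
-- of the extension that `g` belongs to. This is the criterion used for all closure properties
-- below.
theorem IsDeflation.isDefect {Y Z : C} {g : Y ⟶ Z} (hg : 𝓔.IsDeflation g)
    {M : Cᵒᵖ ⥤ AddCommGrpCat.{v}} [M.Additive] {z : M.obj (op Z)} (hM : IsPresentedBy M g z) :
    𝓔.isDefect M := by
  obtain ⟨X, f, δ, h⟩ := hg
  have := 𝓔.additive_defect δ
  obtain ⟨e, -⟩ := hM.exists_iso h.isPresentedBy_defect h.isPresentedBy_defect.map_eq_zero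
    hM.map_eq_zero
  exact ⟨Z, X, δ, ⟨e⟩⟩

theorem exists_isPresentedBy_of_isDefect {M : Cᵒᵖ ⥤ AddCommGrpCat.{v}} (hM : 𝓔.isDefect M) :
    ∃ (X Y Z : C) (f : X ⟶ Y) (g : Y ⟶ Z) (δ : Extension 𝓔.E Z X) (z : M.obj (op Z)),
      𝓔.IsTriangle f g δ ∧ IsPresentedBy M g z := by
  obtain ⟨Z, X, δ, ⟨e⟩⟩ := hM
  obtain ⟨Y, f, g, h⟩ := 𝓔.exists_triangle δ
  exact ⟨X, Y, Z, f, g, δ, _, h, h.isPresentedBy_defect.of_iso e.symm⟩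

end ExtriangulatedStructure


theorem additive_of_mono {C : Type u} [Category.{v} C] [Preadditive C]
    {M N : Cᵒᵖ ⥤ AddCommGrpCat.{v}} (φ : M ⟶ N) [Mono φ] [N.Additive] :
    M.Additive where
  map_add {U V c d} := by
    rw [← cancel_mono (φ.app V), Preadditive.add_comp]
    simp [Functor.map_add]

theorem additive_of_epi {C : Type u} [Category.{v} C] [Preadditive C]
    {M N : Cᵒᵖ ⥤ AddCommGrpCat.{v}} (φ : M ⟶ N) [Epi φ] [M.Additive] :
    N.Additive where
  map_add {U V c d} := by
    rw [← cancel_epi (φ.app U), Preadditive.comp_add]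
    simp [← NatTrans.naturality, Functor.map_add]

namespace ExtriangulatedStructure

variable {C : Type u} [Category.{v} C] [Preadditive C] [HasZeroObject C] [HasBinaryBiproducts C]
  (𝓔 : ExtriangulatedStructure C)

/-! ### Deflations -/

variable {𝓔} in
theorem IsDeflation.of_iso {Y Y' Z : C} {g : Y ⟶ Z} (hg : 𝓔.IsDeflation g) (e : Y ≅ Y')
    {g' : Y' ⟶ Z} (h : e.hom ≫ g' = g) : 𝓔.IsDeflation g' := by
  obtain ⟨X, f, δ, hδ⟩ := hg
  exact ⟨X, f ≫ e.hom, δ, hδ.trans (Quotient.sound ⟨e, rfl, h⟩)⟩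

variable {𝓔} in
theorem IsDeflation.comp {X Y Z : C} {f : X ⟶ Y} {g : Y ⟶ Z} (hf : 𝓔.IsDeflation f)
    (hg : 𝓔.IsDeflation g) : 𝓔.IsDeflation (f ≫ g) := by
  obtain ⟨W, f', δ, hδ⟩ := hf
  obtain ⟨V, g', ρ, hρ⟩ := hg
  obtain ⟨U, h', -, -, δ', h, -⟩ := 𝓔.et4_op f' f δ g' g ρ hδ hρ
  exact ⟨U, h', δ', h⟩

theorem isDeflation_biprod_snd (X Z : C) : 𝓔.IsDeflation (biprod.snd : X ⊞ Z ⟶ Z) :=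
  ⟨X, biprod.inl, 0, 𝓔.s_zero Z X⟩

open ZeroObject in
theorem isDeflation_id (Z : C) : 𝓔.IsDeflation (𝟙 Z) :=
  (𝓔.isDeflation_biprod_snd 0 Z).of_iso
    ⟨biprod.snd, biprod.inr, by ext; all_goals simp, by simp⟩ (by simp)

variable {𝓔} in
theorem IsDeflation.biprod_map {Y Z Y' Z' : C} {g : Y ⟶ Z} {g' : Y' ⟶ Z'}
    (hg : 𝓔.IsDeflation g) (hg' : 𝓔.IsDeflation g') : 𝓔.IsDeflation (biprod.map g g') := by
  obtain ⟨X, f, δ, h⟩ := hg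
  obtain ⟨X', f', δ', h'⟩ := hg'
  exact ⟨_, _, _, 𝓔.s_directSum f g δ f' g' δ' h h'⟩

variable {𝓔} in
-- A shear isomorphism turns `(1, g)` into a split projection, hence a deflation; precompose it with
-- `p ⊕ 1`.
theorem IsDeflation.biprod_desc {P Y Z : C} {p : P ⟶ Z} (hp : 𝓔.IsDeflation p) (g : Y ⟶ Z) :
    𝓔.IsDeflation (biprod.desc p g) := by
  have h : 𝓔.IsDeflation (biprod.desc (𝟙 Z) g) :=
    (𝓔.isDeflation_biprod_snd Y Z).of_iso
      { hom := biprod.desc (biprod.lift (-g) (𝟙 Y)) biprod.inl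
        inv := biprod.desc biprod.inr (biprod.lift (𝟙 Y) g)
        hom_inv_id := by ext <;> simp
        inv_hom_id := by ext <;> simp } (by ext <;> simp)
  have := (hp.biprod_map (𝓔.isDeflation_id Y)).comp h
  rwa [show biprod.map p (𝟙 Y) ≫ biprod.desc (𝟙 Z) g = biprod.desc p g by ext <;> simp] at this

/-- The annihilator of an element of a defect is the image of a deflation. -/
theorem exists_isDeflation_annihilator {M : Cᵒᵖ ⥤ AddCommGrpCat.{v}} (hM : 𝓔.isDefect M)
    {X : C} (x : M.obj (op X)) :
    ∃ (K U : C) (k : K ⟶ U) (e : U ⟶ X) (θ : Extension 𝓔.E X K), 𝓔.IsTriangle k e θ ∧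
      ∀ {W : C} (c : W ⟶ X), M.map c.op x = 0 ↔ ∃ b : W ⟶ U, b ≫ e = c := by
  obtain ⟨K, Y, Z, f, g, δ, z, h, hz⟩ := 𝓔.exists_isPresentedBy_of_isDefect hM
  obtain ⟨d, rfl⟩ := hz.exists_map_eq x
  -- With `x = d^* z`, a morphism `c` kills `x` iff `c ≫ d` kills `δ`, iff `c` kills the pull-back
  -- of `δ` along `d`; hence this extension is the one to realize.
  obtain ⟨U, k, e, he⟩ := 𝓔.exists_triangle (pull d δ)
  refine ⟨K, U, k, e, pull d δ, he, fun {W} c => ?_⟩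
  rw [← he.pull_eq_zero_iff, ← pull_comp, h.pull_eq_zero_iff, ← map_op_comp,
    hz.map_eq_zero_iff]

/-! ### The category of defects is abelian -/

instance : 𝓔.isDefect.IsClosedUnderIsomorphisms where
  of_iso := by
    rintro M N e ⟨Z, X, δ, ⟨e'⟩⟩
    exact ⟨Z, X, δ, ⟨e.symm ≪≫ e'⟩⟩

open ZeroObject in
instance : 𝓔.isDefect.ContainsZero where
  exists_zero := by
    refine ⟨0, isZero_zero _, ?_⟩
    have : (0 : Cᵒᵖ ⥤ AddCommGrpCat.{v}).Additive :=
      ⟨fun {_ _ _ _} => (isZero_zero _).obj _ |>.eq_of_tgt _ _⟩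
    have h (W : C) (m m' : (0 : Cᵒᵖ ⥤ AddCommGrpCat.{v}).obj (op W)) : m = m' :=
      (AddCommGrpCat.subsingleton_of_isZero
        ((isZero_zero (Cᵒᵖ ⥤ AddCommGrpCat.{v})).obj (op W))).elim _ _
    exact (𝓔.isDeflation_id (0 : C)).isDefect (z := 0)
      ⟨fun m => ⟨0, h _ _ _⟩, fun c => ⟨fun _ => ⟨c, Category.comp_id c⟩, fun _ => h _ _ _⟩⟩

/-- If `z` generates `M` and the deflation `e` describes the annihilator of `φ z`, then the preimage
`l` of `e^* z` generates the kernel. The annihilator of `l` equals that of `e^* z` in `M`, so it too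
comes from a deflation. -/
instance : 𝓔.isDefect.IsClosedUnderKernels where
  kernels_le := by
    rintro _ ⟨φ, k, hk, hM, hN⟩
    rename_i M N
    have := 𝓔.additive_of_isDefect hM
    obtain ⟨X, Y, Z, f, g, δ, z, h, hz⟩ := 𝓔.exists_isPresentedBy_of_isDefect hM
    have := Fork.IsLimit.mono hk
    have := additive_of_mono k.ι
    have hex := (ShortComplex.mk _ _ k.condition).exact_of_f_is_kernel
      (IsLimit.ofIsoLimit hk (Fork.ext (Iso.refl _)))
    obtain ⟨_, U, _, e, θ, he, hU⟩ := 𝓔.exists_isDeflation_annihilator hN (φ.app (op Z) z)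
    obtain ⟨l, hl⟩ := app_exact hex (M.map e.op z) (by
      refine (map_op_app φ e z).trans ?_
      exact (hU e).2 ⟨𝟙 _, by simp⟩)
    replace hl : k.ι.app _ l = _ := hl
    obtain ⟨_, V, _, e', θ', he', hV⟩ := 𝓔.exists_isDeflation_annihilator hM (M.map e.op z)
    refine IsDeflation.isDefect ⟨_, _, _, he'⟩ (z := l) ⟨fun {W} m => ?_, fun {W} c => ?_⟩
    · obtain ⟨c, hc⟩ := hz.exists_map_eq (k.ι.app (op W) m)
      obtain ⟨b, rfl⟩ := (hU c).1 (by
        rw [← map_op_app, hc]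
        exact congrArg (fun ψ => ψ.app (op W) m) k.condition)
      refine ⟨b, app_injective k.ι (op W) ?_⟩
      rw [map_op_app, hl, ← hc, map_op_comp]
    · rw [← hV, ← hl, ← map_op_app]
      exact (map_eq_zero_iff _ (app_injective k.ι (op W))).symm

/-- If `φ z = d^* z'` for generators `z`, `z'`, then the cokernel is generated by the class of `z'`,
with the relations `g'` of `N` together with `d`; thus `(g', d)` presents it. -/
instance : 𝓔.isDefect.IsClosedUnderCokernels where
  cokernels_le := by
    rintro _ ⟨φ, k, hk, hM, hN⟩
    rename_i M N
    have := 𝓔.additive_of_isDefect hN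
    obtain ⟨_, _, Z, _, _, _, z, _, hz⟩ := 𝓔.exists_isPresentedBy_of_isDefect hM
    obtain ⟨_, Y', Z', _, g', δ', z', h', hz'⟩ := 𝓔.exists_isPresentedBy_of_isDefect hN
    have := Cofork.IsColimit.epi hk
    have := additive_of_epi k.π
    have hex := (ShortComplex.mk _ _ k.condition).exact_of_g_is_cokernel
      (IsColimit.ofIsoColimit hk (Cofork.ext (Iso.refl _)))
    obtain ⟨d, hd⟩ := hz'.exists_map_eq (φ.app _ z)
    refine (IsDeflation.biprod_desc ⟨_, _, _, h'⟩ d).isDefect (z := k.π.app _ z')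
      ⟨fun {W} m => ?_, fun {W} c => ?_⟩
    · obtain ⟨n, rfl⟩ := app_surjective k.π (op W) m
      obtain ⟨c, rfl⟩ := hz'.exists_map_eq n
      exact ⟨c, (map_op_app k.π c z').symm⟩
    · constructor
      · intro hc
        obtain ⟨m, hm⟩ := app_exact hex (N.map c.op z') ((map_op_app k.π c z').trans hc)
        obtain ⟨a, rfl⟩ := hz.exists_map_eq m
        replace hm : φ.app _ (M.map a.op z) = _ := hm
        rw [map_op_app, ← hd, ← map_op_comp] at hm
        obtain ⟨b, hb⟩ := (hz'.map_eq_zero_iff (c - a ≫ d)).1 (by rw [map_op_sub, hm, sub_self])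
        exact ⟨biprod.lift b a, by simp [hb]⟩
      · rintro ⟨b, rfl⟩
        refine (map_op_app k.π _ z').symm.trans ?_
        have : b ≫ biprod.desc g' d = (b ≫ biprod.fst) ≫ g' + (b ≫ biprod.snd) ≫ d := by
          simp [biprod.desc_eq]
        rw [this, map_op_add, map_op_comp, hz'.map_eq_zero, map_zero, zero_add, map_op_comp, hd,
          ← map_op_app]
        exact congrArg (fun ψ => ψ.app (op W) (M.map (b ≫ biprod.snd).op z)) k.condition

theorem isDefect_biprod {M N : Cᵒᵖ ⥤ AddCommGrpCat.{v}} (hM : 𝓔.isDefect M)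
    (hN : 𝓔.isDefect N) : 𝓔.isDefect (M ⊞ N) := by
  have := 𝓔.additive_of_isDefect hM
  have := 𝓔.additive_of_isDefect hN
  obtain ⟨_, Y, Z, _, g, _, z, h, hz⟩ := 𝓔.exists_isPresentedBy_of_isDefect hM
  obtain ⟨_, Y', Z', _, g', _, z', h', hz'⟩ := 𝓔.exists_isPresentedBy_of_isDefect hN
  have hext {W : C} {x y : (M ⊞ N).obj (op W)}
      (h₁ : (biprod.fst : M ⊞ N ⟶ M).app _ x = (biprod.fst : M ⊞ N ⟶ M).app _ y)
      (h₂ : (biprod.snd : M ⊞ N ⟶ N).app _ x = (biprod.snd : M ⊞ N ⟶ N).app _ y) : x = y := by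
    have h (x : (M ⊞ N).obj (op W)) :
        (biprod.inl : M ⟶ M ⊞ N).app _ ((biprod.fst : M ⊞ N ⟶ M).app _ x) +
        (biprod.inr : N ⟶ M ⊞ N).app _ ((biprod.snd : M ⊞ N ⟶ N).app _ x) = x :=
      congrArg (fun ψ => ψ.app (op W) x) (biprod.total (X := M) (Y := N))
    rw [← h x, ← h y, h₁, h₂]
  have hfst {W : C} (m : M.obj (op W)) (n : N.obj (op W)) : (biprod.fst : M ⊞ N ⟶ M).app _
      ((biprod.inl : M ⟶ M ⊞ N).app _ m + (biprod.inr : N ⟶ M ⊞ N).app _ n) = m := by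
    rw [map_add, ← NatTrans.comp_app_apply, ← NatTrans.comp_app_apply]
    simp
  have hsnd {W : C} (m : M.obj (op W)) (n : N.obj (op W)) : (biprod.snd : M ⊞ N ⟶ N).app _
      ((biprod.inl : M ⟶ M ⊞ N).app _ m + (biprod.inr : N ⟶ M ⊞ N).app _ n) = n := by
    rw [map_add, ← NatTrans.comp_app_apply, ← NatTrans.comp_app_apply]
    simp
  have hadd : (M ⊞ N).Additive := ⟨fun {U V c d} => by
    ext x
    refine hext ?_ ?_
    · simp only [NatTrans.naturality_apply, Functor.map_add, AddCommGrpCat.hom_add_apply, map_add]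
    · simp only [NatTrans.naturality_apply, Functor.map_add, AddCommGrpCat.hom_add_apply, map_add]⟩
  refine (IsDeflation.biprod_map ⟨_, _, _, h⟩ ⟨_, _, _, h'⟩).isDefect
    (z := (biprod.inl : M ⟶ M ⊞ N).app _ (M.map (biprod.fst : Z ⊞ Z' ⟶ Z).op z) +
      (biprod.inr : N ⟶ M ⊞ N).app _ (N.map (biprod.snd : Z ⊞ Z' ⟶ Z').op z'))
    ⟨fun {W} m => ?_, fun {W} c => ?_⟩
  · obtain ⟨c, hc⟩ := hz.exists_map_eq ((biprod.fst : M ⊞ N ⟶ M).app _ m)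
    obtain ⟨d, hd⟩ := hz'.exists_map_eq ((biprod.snd : M ⊞ N ⟶ N).app _ m)
    refine ⟨biprod.lift c d, hext ?_ ?_⟩
    · rw [map_op_app, hfst, ← map_op_comp, biprod.lift_fst, hc]
    · rw [map_op_app, hsnd, ← map_op_comp, biprod.lift_snd, hd]
  · constructor
    · intro hc
      have h₁ := congrArg ((biprod.fst : M ⊞ N ⟶ M).app _) hc
      have h₂ := congrArg ((biprod.snd : M ⊞ N ⟶ N).app _) hc
      rw [map_op_app, hfst, ← map_op_comp, map_zero, hz.map_eq_zero_iff] at h₁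
      rw [map_op_app, hsnd, ← map_op_comp, map_zero, hz'.map_eq_zero_iff] at h₂
      obtain ⟨b, hb⟩ := h₁
      obtain ⟨b', hb'⟩ := h₂
      exact ⟨biprod.lift b b', by ext <;> simp [hb, hb']⟩
    · rintro ⟨b, rfl⟩
      refine hext ?_ ?_
      · rw [map_op_app, hfst, ← map_op_comp, map_zero, hz.map_eq_zero_iff]
        exact ⟨b ≫ biprod.fst, by simp⟩
      · rw [map_op_app, hsnd, ← map_op_comp, map_zero, hz'.map_eq_zero_iff]
        exact ⟨b ≫ biprod.snd, by simp⟩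

instance : 𝓔.isDefect.IsClosedUnderBinaryProducts where
  limitsOfShape_le := by
    rintro M ⟨p⟩
    exact 𝓔.isDefect.prop_of_iso
      (IsLimit.conePointsIsoOfNatIso p.isLimit (BinaryBiproduct.isLimit _ _)
        (diagramIsoPair p.diag)).symm
      (𝓔.isDefect_biprod (p.prop_diag_obj ⟨.left⟩) (p.prop_diag_obj ⟨.right⟩))

instance : 𝓔.isDefect.IsClosedUnderFiniteProducts := .mk'

instance : Abelian 𝓔.Def := inferInstance

end ExtriangulatedStructure


namespace ExtriangulatedStructure

variable {C : Type u} [Category.{v} C] [Preadditive C] [HasZeroObject C] [HasBinaryBiproducts C]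
  (𝓔 : ExtriangulatedStructure C)

/-! ### The left adjoint of the inclusion of defects -/

variable {𝓔} in
-- Up to isomorphism, the values of a defect at `P` are subgroups of groups `𝔼(P, X) = 0`.
theorem IsProjective.eq_zero_of_isDefect {P : C} (hP : 𝓔.IsProjective P)
    {M : Cᵒᵖ ⥤ AddCommGrpCat.{v}} (hM : 𝓔.isDefect M) (m : M.obj (op P)) : m = 0 := by
  obtain ⟨_, _, Z, _, _, δ, z, h, hz⟩ := 𝓔.exists_isPresentedBy_of_isDefect hM
  obtain ⟨c, rfl⟩ := hz.exists_map_eq m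
  rw [hz.map_eq_zero_iff, ← h.pull_eq_zero_iff]
  exact hP _ _

theorem exists_isProjective_isDeflation (h : 𝓔.HasEnoughProjectives) (Z : C) :
    ∃ (P : C) (p : P ⟶ Z), 𝓔.IsProjective P ∧ 𝓔.IsDeflation p := by
  obtain ⟨X, P, f, p, δ, hP, hδ⟩ := h Z
  exact ⟨P, p, hP, X, f, δ, hδ⟩

variable {𝓔} in
theorem IsDeflation.exists_isPresentedBy {Y Z : C} {g : Y ⟶ Z} (hg : 𝓔.IsDeflation g) :
    ∃ (N : 𝓔.Def) (n : N.obj.obj (op Z)), IsPresentedBy N.obj g n := by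
  obtain ⟨X, f, δ, h⟩ := hg
  exact ⟨⟨𝓔.defect δ, Z, X, δ, ⟨Iso.refl _⟩⟩, 𝓔.defectGenerator δ, h.isPresentedBy_defect⟩

/-- The reflection is presented by `(p, g)` with `p : P ⟶ Z` a deflation from a projective. A
morphism from `M` to a defect `N'` is an element killed by `g`; it is killed by `p` automatically
since `N'` vanishes on `P`. -/
theorem exists_reflection (h : 𝓔.HasEnoughProjectives) (M : FPMod C) :
    ∃ (N : 𝓔.Def) (η : M ⟶ 𝓔.incl.obj N), ∀ N' : 𝓔.Def,
      Function.Bijective (fun k : N ⟶ N' => η ≫ 𝓔.incl.map k) := by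
  have := M.property.1
  obtain ⟨Y, Z, g, z, hz⟩ := isFinitelyPresented_exists M.property
  obtain ⟨P, p, hP, hp⟩ := 𝓔.exists_isProjective_isDeflation h Z
  obtain ⟨N, n, hn⟩ := (hp.biprod_desc g).exists_isPresentedBy
  obtain ⟨η, hη⟩ := hz.exists_hom (n := n) ((hn.map_eq_zero_iff g).2 ⟨biprod.inr, by simp⟩)
  refine ⟨N, ObjectProperty.homMk η, fun N' => ⟨fun k k' e => ?_, fun f => ?_⟩⟩
  · apply ObjectProperty.hom_ext
    apply hn.hom_ext
    rw [← hη]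
    exact congrArg (fun ψ => ψ.hom.app (op Z) z) e
  · obtain ⟨k, hk⟩ := hn.exists_hom (N := N'.obj) (n := f.hom.app _ z) (by
      have key (n' : N'.obj.obj (op Z)) (hn' : N'.obj.map g.op n' = 0) :
          N'.obj.map (biprod.desc p g).op n' = 0 := by
        have : biprod.desc p g = biprod.fst ≫ p + biprod.snd ≫ g := biprod.desc_eq
        rw [this, map_op_add, map_op_comp, hP.eq_zero_of_isDefect N'.property (N'.obj.map p.op _),
          map_zero, zero_add, map_op_comp, hn', map_zero]
      refine key _ ((map_op_app f.hom g z).symm.trans ?_)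
      rw [hz.map_eq_zero]
      exact map_zero _)
    refine ⟨ObjectProperty.homMk k, ?_⟩
    apply ObjectProperty.hom_ext
    apply hz.hom_ext
    refine Eq.trans ?_ hk
    exact congrArg _ hη

theorem isRightAdjoint_incl (h : 𝓔.HasEnoughProjectives) : 𝓔.incl.IsRightAdjoint := by
  choose N η hη using 𝓔.exists_reflection h
  exact ⟨_, ⟨Adjunction.adjunctionOfEquivLeft
    (fun M N' => Equiv.ofBijective _ (hη M N')) (by simp)⟩⟩

/-- The element of the reflection of `C(-, X)` that corresponds to the unit. -/
def unitElement {Γ : FPMod C ⥤ 𝓔.Def} (adj : Γ ⊣ 𝓔.incl) (X : C) :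
    (Γ.obj ((yonedaMod C).obj X)).obj.obj (op X) :=
  yonedaElement (adj.unit.app ((yonedaMod C).obj X)).hom

theorem map_unitElement {Γ : FPMod C ⥤ 𝓔.Def} (adj : Γ ⊣ 𝓔.incl) {X Y : C} (f : X ⟶ Y) :
    (Γ.map ((yonedaMod C).map f)).hom.app (op X) (𝓔.unitElement adj X) =
      (Γ.obj ((yonedaMod C).obj Y)).obj.map f.op (𝓔.unitElement adj Y) := by
  have h := congrArg (fun ψ => ψ.hom.app (op X) (𝟙 X : X ⟶ X))
    (adj.unit.naturality ((yonedaMod C).map f))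
  refine Eq.trans h.symm ?_
  refine Eq.trans ?_ (preadditiveYoneda_app (adj.unit.app ((yonedaMod C).obj Y)).hom f)
  exact congrArg ((adj.unit.app ((yonedaMod C).obj Y)).hom.app (op X)) (Category.id_comp f)

/-- As `Γ` is an arbitrary left adjoint, its value is identified by universal properties: the
adjunction yields a morphism to the module presented by `p`, and one back exists because defects
vanish on `P`. -/
theorem isPresentedBy_unitElement {Γ : FPMod C ⥤ 𝓔.Def} (adj : Γ ⊣ 𝓔.incl) {P X : C}
    {p : P ⟶ X} (hP : 𝓔.IsProjective P) (hp : 𝓔.IsDeflation p) :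
    IsPresentedBy (Γ.obj ((yonedaMod C).obj X)).obj p (𝓔.unitElement adj X) := by
  obtain ⟨N, n, hn⟩ := hp.exists_isPresentedBy
  let R := Γ.obj ((yonedaMod C).obj X)
  -- A representable functor is free on the identity, so the zero morphism serves as its relation.
  have hX : IsPresentedBy (preadditiveYoneda.obj X) (0 : X ⟶ X) (𝟙 X : X ⟶ X) :=
    ⟨fun m => ⟨m, Category.comp_id m⟩, fun c => by
      constructor
      · intro hc
        exact ⟨c, by rw [comp_zero]; exact hc.symm.trans (Category.comp_id c)⟩
      · rintro ⟨b, rfl⟩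
        rw [comp_zero]
        exact map_op_zero _ _⟩
  obtain ⟨ψ, hψ⟩ := hX.exists_hom (n := n) (map_op_zero _ _)
  let ψ' : (yonedaMod C).obj X ⟶ 𝓔.incl.obj N := ObjectProperty.homMk ψ
  let φ : R ⟶ N := (adj.homEquiv ((yonedaMod C).obj X) N).symm ψ'
  have hφ' : adj.unit.app ((yonedaMod C).obj X) ≫ 𝓔.incl.map φ = ψ' :=
    (adj.homEquiv_unit _ _ _).symm.trans (Equiv.apply_symm_apply _ _)
  have hφ : φ.hom.app (op X) (𝓔.unitElement adj X) = n :=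
    (congrArg (fun ψ => ψ.hom.app (op X) (𝟙 X : X ⟶ X)) hφ').trans hψ
  obtain ⟨χ, hχ⟩ := hn.exists_hom (N := R.obj) (n := 𝓔.unitElement adj X)
    (hP.eq_zero_of_isDefect R.property _)
  have h₁ : φ ≫ ObjectProperty.homMk χ = 𝟙 R := by
    apply (adj.homEquiv _ _).injective
    apply ObjectProperty.hom_ext
    apply hX.hom_ext
    rw [adj.homEquiv_unit, adj.homEquiv_unit]
    refine ((congrArg (χ.app (op X)) hφ).trans hχ).trans ?_
    have h : adj.unit.app ((yonedaMod C).obj X) ≫ 𝓔.incl.map (𝟙 R) =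
        adj.unit.app ((yonedaMod C).obj X) := by
      rw [CategoryTheory.Functor.map_id]
      exact Category.comp_id _
    exact congrArg (fun ψ => ψ.hom.app (op X) (𝟙 X : X ⟶ X)) h.symm
  have h₂ : χ ≫ φ.hom = 𝟙 N.obj := hn.hom_ext (by simp [hφ, hχ])
  have := hn.of_iso ⟨χ, φ.hom, h₂, congrArg (fun ψ => ψ.hom) h₁⟩
  rwa [hχ] at this

end ExtriangulatedStructure



/-! ### Extending an additive functor to defects by cokernels -/

/-- A module with a chosen presentation. -/
structure Presentation {C : Type u} [Category.{v} C] (M : Cᵒᵖ ⥤ AddCommGrpCat.{v}) where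
  /-- the object of relations -/
  rel : C
  /-- the generating object -/
  gen : C
  /-- the presenting morphism -/
  hom : rel ⟶ gen
  /-- the generator -/
  elt : M.obj (op gen)
  isPresentedBy : IsPresentedBy M hom elt

namespace Presentation

variable {C : Type u} [Category.{v} C] [Preadditive C] {A : Type u₁} [Category.{v₁} A] [Abelian A]
  (H : C ⥤ A) [H.Additive] {M : Cᵒᵖ ⥤ AddCommGrpCat.{v}} [M.Additive] (p : Presentation M)

/-- The morphism to the cokernel of the image of a presentation that is induced by an element of
the presented module. -/
def ev {W : C} (m : M.obj (op W)) : H.obj W ⟶ cokernel (H.map p.hom) :=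
  H.map (p.isPresentedBy.exists_map_eq m).choose ≫ cokernel.π _

/-- Independence of the chosen morphism: two choices differ by a morphism through `p.hom`, which
dies in the cokernel. -/
theorem ev_map_elt {W : C} (c : W ⟶ p.gen) :
    p.ev H (M.map c.op p.elt) = H.map c ≫ cokernel.π (H.map p.hom) := by
  have h := (p.isPresentedBy.exists_map_eq (M.map c.op p.elt)).choose_spec
  obtain ⟨b, hb⟩ := (p.isPresentedBy.map_eq_zero_iff _).1
    ((map_op_sub M _ c p.elt).trans (sub_eq_zero.2 h))
  rw [ev, ← sub_eq_zero, ← Preadditive.sub_comp, ← H.map_sub, ← hb, H.map_comp, Category.assoc,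
    cokernel.condition, comp_zero]

theorem ev_elt : p.ev H p.elt = cokernel.π (H.map p.hom) := by
  simpa using p.ev_map_elt H (𝟙 _)

theorem ev_map {V W : C} (c : V ⟶ W) (m : M.obj (op W)) :
    p.ev H (M.map c.op m) = H.map c ≫ p.ev H m := by
  obtain ⟨d, rfl⟩ := p.isPresentedBy.exists_map_eq m
  rw [← map_op_comp, ev_map_elt, ev_map_elt, H.map_comp, Category.assoc]

theorem ev_zero (W : C) : p.ev H (0 : M.obj (op W)) = 0 := by
  rw [← map_op_zero M p.elt, ev_map_elt, H.map_zero, zero_comp]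

theorem ev_add {W : C} (m m' : M.obj (op W)) : p.ev H (m + m') = p.ev H m + p.ev H m' := by
  obtain ⟨c, rfl⟩ := p.isPresentedBy.exists_map_eq m
  obtain ⟨d, rfl⟩ := p.isPresentedBy.exists_map_eq m'
  rw [← map_op_add, ev_map_elt, ev_map_elt, ev_map_elt, H.map_add, Preadditive.add_comp]

theorem epi_ev {Z : C} {z : M.obj (op Z)}
    (hz : ∀ {W : C} (m : M.obj (op W)), ∃ c : W ⟶ Z, M.map c.op z = m) : Epi (p.ev H z) := by
  obtain ⟨c, hc⟩ := hz p.elt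
  have : H.map c ≫ p.ev H z = cokernel.π _ := by rw [← ev_map, hc, ev_elt]
  exact epi_of_epi_fac this

variable {p} in
theorem map_comp_ev {Y Z : C} {g : Y ⟶ Z} {z : M.obj (op Z)} (hz : IsPresentedBy M g z) :
    H.map g ≫ p.ev H z = 0 := by
  rw [← ev_map, hz.map_eq_zero, ev_zero]

variable {p} in
-- Independence of the presentation: the generators of the two presentations are multiples of each
-- other, and `d ≫ c` is the identity modulo `g`. So `p.ev H z` is also a cokernel of `H.map g`,
-- which lets later arguments use whichever presentation is convenient.
theorem exact_ev {Y Z : C} {g : Y ⟶ Z} {z : M.obj (op Z)} (hz : IsPresentedBy M g z) :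
    (ShortComplex.mk (H.map g) (p.ev H z) (map_comp_ev H hz)).Exact := by
  have := p.epi_ev H hz.exists_map_eq
  obtain ⟨c, hc⟩ := hz.exists_map_eq p.elt
  obtain ⟨d, hd⟩ := p.isPresentedBy.exists_map_eq z
  obtain ⟨b, hb⟩ := (hz.map_eq_zero_iff (p.hom ≫ c)).1 (by
    rw [map_op_comp, hc, p.isPresentedBy.map_eq_zero])
  obtain ⟨b', hb'⟩ := (hz.map_eq_zero_iff (d ≫ c - 𝟙 Z)).1 (by
    rw [map_op_sub, map_op_comp, hc, hd]; simp)
  refine ShortComplex.exact_of_g_is_cokernel _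
    (CokernelCofork.IsColimit.ofπ' _ _ fun {T} k hk => ⟨cokernel.desc _ (H.map c ≫ k) ?_, ?_⟩)
  · rw [← H.map_comp_assoc, ← hb, H.map_comp_assoc, hk, comp_zero]
  · have hev : p.ev H z = H.map d ≫ cokernel.π (H.map p.hom) := by rw [← hd, ev_map_elt]
    have hsub : H.map b' ≫ H.map g = H.map d ≫ H.map c - 𝟙 _ := by
      rw [← H.map_comp, hb', H.map_sub, H.map_comp, H.map_id]
    dsimp at k hk ⊢
    have := hsub =≫ k
    rw [Category.assoc, hk, comp_zero, Preadditive.sub_comp, Category.id_comp] at this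
    refine (congrArg (· ≫ _) hev).trans ?_
    rw [Category.assoc, cokernel.π_desc, ← Category.assoc]
    exact (sub_eq_zero.1 this.symm)

end Presentation

namespace ExtriangulatedStructure

variable {C : Type u} [Category.{v} C] [Preadditive C] [HasZeroObject C] [HasBinaryBiproducts C]
  (𝓔 : ExtriangulatedStructure C)

/-- A chosen presentation of a defect. -/
def presentation (M : 𝓔.Def) : Presentation M.obj :=
  Nonempty.some <| by
    obtain ⟨_, Y, Z, _, g, _, z, _, hz⟩ := 𝓔.exists_isPresentedBy_of_isDefect M.property
    exact ⟨⟨Y, Z, g, z, hz⟩⟩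

section Extension

variable {A : Type u₁} [Category.{v₁} A] [Abelian A] (H : C ⥤ A) [H.Additive]

/-- The extension of an additive functor `H` to the category of defects that sends a module
presented by `g` to the cokernel of `H.map g`. -/
def extendDef : 𝓔.Def ⥤ A where
  obj M := cokernel (H.map (𝓔.presentation M).hom)
  map {M N} φ := cokernel.desc _ ((𝓔.presentation N).ev H (φ.hom.app _ (𝓔.presentation M).elt)) (by
    rw [← Presentation.ev_map, ← map_op_app, (𝓔.presentation M).isPresentedBy.map_eq_zero, map_zero,
      Presentation.ev_zero])
  map_id M := by
    ext
    simp [Presentation.ev_elt]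
  map_comp {L M N} φ ψ := by
    ext
    obtain ⟨c, hc⟩ :=
      (𝓔.presentation M).isPresentedBy.exists_map_eq (φ.hom.app _ (𝓔.presentation L).elt)
    simp only [cokernel.π_desc, cokernel.π_desc_assoc]
    rw [← hc, Presentation.ev_map_elt, Category.assoc, cokernel.π_desc, ← Presentation.ev_map,
      ← map_op_app, hc]
    rfl

/-- The morphism `H.obj W ⟶ (𝓔.extendDef H).obj M` induced by an element of `M`. -/
def ev (M : 𝓔.Def) {W : C} (m : M.obj.obj (op W)) : H.obj W ⟶ (𝓔.extendDef H).obj M :=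
  (𝓔.presentation M).ev H m

theorem ev_comp_map {M N : 𝓔.Def} (φ : M ⟶ N) {W : C} (m : M.obj.obj (op W)) :
    𝓔.ev H M m ≫ (𝓔.extendDef H).map φ = 𝓔.ev H N (φ.hom.app _ m) := by
  obtain ⟨c, rfl⟩ := (𝓔.presentation M).isPresentedBy.exists_map_eq m
  rw [ev, Presentation.ev_map_elt, map_op_app, ev, Presentation.ev_map]
  refine (Category.assoc _ _ _).trans ?_
  congr 1
  exact cokernel.π_desc _ _ _

theorem ev_map (M : 𝓔.Def) {V W : C} (c : V ⟶ W) (m : M.obj.obj (op W)) :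
    𝓔.ev H M (M.obj.map c.op m) = H.map c ≫ 𝓔.ev H M m :=
  Presentation.ev_map _ _ _ _

theorem ev_zero (M : 𝓔.Def) (W : C) : 𝓔.ev H M (0 : M.obj.obj (op W)) = 0 :=
  Presentation.ev_zero _ _ _

theorem epi_ev (M : 𝓔.Def) {Z : C} {z : M.obj.obj (op Z)}
    (hz : ∀ {W : C} (m : M.obj.obj (op W)), ∃ c : W ⟶ Z, M.obj.map c.op z = m) :
    Epi (𝓔.ev H M z) :=
  Presentation.epi_ev _ _ hz

theorem exists_eq_comp_map_of_comp_ev_eq_zero (M : 𝓔.Def) {Y Z : C} {g : Y ⟶ Z}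
    {z : M.obj.obj (op Z)} (hz : IsPresentedBy M.obj g z) {T : A} (x : T ⟶ H.obj Z)
    (hx : x ≫ 𝓔.ev H M z = 0) :
    ∃ (T' : A) (π : T' ⟶ T) (_ : Epi π) (y : T' ⟶ H.obj Y), π ≫ x = y ≫ H.map g :=
  (Presentation.exact_ev (p := 𝓔.presentation M) H hz).exact_up_to_refinements x hx

instance : (𝓔.extendDef H).Additive where
  map_add {M N φ ψ} := by
    have := 𝓔.epi_ev H M (𝓔.presentation M).isPresentedBy.exists_map_eq
    rw [← cancel_epi (𝓔.ev H M (𝓔.presentation M).elt), Preadditive.comp_add, ev_comp_map,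
      ev_comp_map, ev_comp_map]
    exact Presentation.ev_add H _ _ _

end Extension

/-! ### Exactness of the extension -/

instance : 𝓔.isDefect.ι.PreservesHomology where
  preservesKernels := 𝓔.isDefect.preservesKernels_ι
  preservesCokernels := 𝓔.isDefect.preservesCokernels_ι

instance : PreservesFiniteLimits 𝓔.isDefect.ι :=
  𝓔.isDefect.ι.preservesFiniteLimits_of_preservesHomology

instance : PreservesFiniteColimits 𝓔.isDefect.ι :=
  𝓔.isDefect.ι.preservesFiniteColimits_of_preservesHomology

variable {𝓔} in
-- Apply (ET3) to a morphism from the split triangle `X ⟶ X ⊞ 0 ⟶ 0`, where the composite vanishes.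
theorem IsTriangle.comp_eq_zero {X Y Z : C} {f : X ⟶ Y} {g : Y ⟶ Z} {δ : Extension 𝓔.E Z X}
    (h : 𝓔.IsTriangle f g δ) : f ≫ g = 0 := by
  open ZeroObject in
  obtain ⟨c, hc, -⟩ := 𝓔.et3 _ _ _ f g δ (𝓔.s_zero (0 : C) X) h (𝟙 X) (biprod.desc f 0) (by simp)
  have := biprod.inl ≫= hc
  simpa using this.symm

variable {𝓔} in
-- Presentations are chosen compatibly: `z` generates the middle term, its image generates the
-- quotient with relations `e : U ⟶ Z`, and the element `l` over `e^* z` generates the subobject.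
-- Right exactness is then formal; half exactness, applied to the triangle of `e`, is needed only
-- for the monomorphism.
theorem IsHalfExact.map_extendDef_shortExact {A : Type u₁} [Category.{v₁} A] [Abelian A]
    {H : C ⥤ A} [H.Additive] (hH : 𝓔.IsHalfExact H) {S : ShortComplex 𝓔.Def}
    (hS : S.ShortExact) : (S.map (𝓔.extendDef H)).ShortExact := by
  have hS' := hS.map_of_exact 𝓔.isDefect.ι
  have := hS'.mono_f
  have := hS'.epi_g
  have hinj (W : C) : Function.Injective (S.f.hom.app (op W)) :=
    app_injective (S.map 𝓔.isDefect.ι).f (op W)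
  have hsurj (W : C) : Function.Surjective (S.g.hom.app (op W)) :=
    app_surjective (S.map 𝓔.isDefect.ι).g (op W)
  have hex {W : C} (m : S.X₂.obj.obj (op W)) (hm : S.g.hom.app _ m = 0) :
      ∃ l, S.f.hom.app (op W) l = m := app_exact hS'.exact m hm
  have hzero {W : C} (m : S.X₁.obj.obj (op W)) : S.g.hom.app _ (S.f.hom.app _ m) = 0 :=
    congrArg (fun ψ => ψ.hom.app (op W) m) S.zero
  obtain ⟨X, Y, Z, f, g, δ, z, h, hz⟩ := 𝓔.exists_isPresentedBy_of_isDefect S.X₂.property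
  obtain ⟨K, U, k, e, θ, he, hU⟩ :=
    𝓔.exists_isDeflation_annihilator S.X₃.property (S.g.hom.app _ z)
  have hn : IsPresentedBy S.X₃.obj e (S.g.hom.app _ z) := ⟨fun {W} m => by
    obtain ⟨m, rfl⟩ := hsurj W m
    obtain ⟨c, rfl⟩ := hz.exists_map_eq m
    exact ⟨c, (map_op_app S.g.hom c z).symm⟩, hU⟩
  obtain ⟨b, hb⟩ := (hU g).1 (by rw [← map_op_app, hz.map_eq_zero, map_zero])
  obtain ⟨l, hl⟩ := hex (S.X₂.obj.map e.op z) (by rw [map_op_app, hn.map_eq_zero])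
  have hl' {W : C} (m : S.X₁.obj.obj (op W)) : ∃ c : W ⟶ U, S.X₁.obj.map c.op l = m := by
    obtain ⟨c, hc⟩ := hz.exists_map_eq (S.f.hom.app _ m)
    obtain ⟨d, rfl⟩ := (hU c).1 (by rw [← map_op_app, hc, hzero])
    exact ⟨d, hinj W (by rw [map_op_app, hl, ← map_op_comp, hc])⟩
  -- Both `b` and `k` are relations of `l`, because `b ≫ e = g` kills `z` and `k ≫ e = 0`.
  have hbl : S.X₁.obj.map b.op l = 0 :=
    hinj _ (by rw [map_op_app, hl, ← map_op_comp, hb, hz.map_eq_zero, map_zero])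
  have hkl : S.X₁.obj.map k.op l = 0 :=
    hinj _ (by rw [map_op_app, hl, ← map_op_comp, he.comp_eq_zero, map_op_zero, map_zero])
  have epi_l := 𝓔.epi_ev H S.X₁ hl'
  have epi_z := 𝓔.epi_ev H S.X₂ hz.exists_map_eq
  have epi_n := 𝓔.epi_ev H S.X₃ hn.exists_map_eq
  have hel : H.map e ≫ 𝓔.ev H S.X₂ z = 𝓔.ev H S.X₁ l ≫ (𝓔.extendDef H).map S.f := by
    rw [ev_comp_map, hl, ev_map]
  have hzn : 𝓔.ev H S.X₂ z ≫ (𝓔.extendDef H).map S.g = 𝓔.ev H S.X₃ (S.g.hom.app _ z) :=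
    𝓔.ev_comp_map H _ _
  have hmono : Mono ((𝓔.extendDef H).map S.f) := by
    refine Preadditive.mono_of_cancel_zero _ fun {T} x hx => ?_
    obtain ⟨T₁, π₁, _, x₁, hx₁⟩ := surjective_up_to_refinements_of_epi (𝓔.ev H S.X₁ l) x
    -- Up to refinement, `x₁ ≫ H e` factors through `H g = H b ≫ H e`. Thus `x₁` minus a term
    -- through `H b` is killed by `H e`, hence comes from `H k`; the evaluation at `l` kills both
    -- terms.
    obtain ⟨T₂, π₂, _, x₂, hx₂⟩ := 𝓔.exists_eq_comp_map_of_comp_ev_eq_zero H S.X₂ hz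
      (x₁ ≫ H.map e) (by rw [Category.assoc, hel, ← reassoc_of% hx₁, hx, comp_zero])
    obtain ⟨w, hw⟩ := hH.exact k e θ he
    obtain ⟨T₃, π₃, _, (x₃ : T₃ ⟶ H.obj K),
      (hx₃ : π₃ ≫ (π₂ ≫ x₁ - x₂ ≫ H.map b) = x₃ ≫ H.map k)⟩ := hw.exact_up_to_refinements
      (π₂ ≫ x₁ - x₂ ≫ H.map b) (by
        dsimp
        rw [Preadditive.sub_comp, Category.assoc, hx₂, Category.assoc, ← H.map_comp, hb, sub_self])
    rw [← cancel_epi π₁, ← cancel_epi π₂, ← cancel_epi π₃, hx₁, comp_zero, comp_zero, comp_zero]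
    have := hx₃ =≫ 𝓔.ev H S.X₁ l
    simpa only [Preadditive.comp_sub, Preadditive.sub_comp, Category.assoc, ← ev_map, hbl, hkl,
      ev_zero, comp_zero, sub_zero] using this
  have hepi : Epi ((𝓔.extendDef H).map S.g) := epi_of_epi_fac hzn
  have hexact {T : A} (t : T ⟶ (𝓔.extendDef H).obj S.X₂) (ht : t ≫ (𝓔.extendDef H).map S.g = 0) :
      ∃ (T' : A) (π : T' ⟶ T) (_ : Epi π) (s : T' ⟶ (𝓔.extendDef H).obj S.X₁),
        π ≫ t = s ≫ (𝓔.extendDef H).map S.f := by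
    obtain ⟨T₁, π₁, _, x₁, hx₁⟩ := surjective_up_to_refinements_of_epi (𝓔.ev H S.X₂ z) t
    obtain ⟨T₂, π₂, _, x₂, hx₂⟩ := 𝓔.exists_eq_comp_map_of_comp_ev_eq_zero H S.X₃ hn x₁ (by
      rw [← hzn, ← reassoc_of% hx₁, ht, comp_zero])
    refine ⟨T₂, π₂ ≫ π₁, epi_comp _ _, x₂ ≫ 𝓔.ev H S.X₁ l, ?_⟩
    rw [Category.assoc, hx₁, reassoc_of% hx₂, hel, Category.assoc]
  exact { exact := (ShortComplex.exact_iff_exact_up_to_refinements _).2 fun T t ht => hexact t ht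
          mono_f := hmono
          epi_g := hepi }

end ExtriangulatedStructure



/-! ### Factorization of the functor through the Serre quotient -/

/-- An exact functor that reflects zero objects is faithful. -/
theorem faithful_of_isZero {B : Type u₁} [Category.{v₁} B] [Abelian B] {A : Type u₂}
    [Category.{v₂} A] [Abelian A] (F : B ⥤ A) [F.Additive] [PreservesFiniteLimits F]
    [PreservesFiniteColimits F] (hF : ∀ X, IsZero (F.obj X) → IsZero X) : F.Faithful := by
  have key {X Y : B} (f : X ⟶ Y) (hf : F.map f = 0) : f = 0 := by
    have h : F.map (Abelian.image.ι f) = 0 := by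
      rw [← cancel_epi (F.map (Abelian.factorThruImage f)), ← F.map_comp, Abelian.image.fac, hf,
        comp_zero]
    have := (hF _ (IsZero.of_mono_eq_zero _ h)).eq_of_src (Abelian.image.ι f) 0
    rw [← Abelian.image.fac f, this, comp_zero]
  exact ⟨fun {X Y f g} e => sub_eq_zero.1 (key _ (by rw [F.map_sub, e, sub_self]))⟩

namespace ExtriangulatedStructure

variable {C : Type u} [Category.{v} C] [Preadditive C] [HasZeroObject C] [HasBinaryBiproducts C]
  (𝓔 : ExtriangulatedStructure C) {A : Type u₁} [Category.{v₁} A] [Abelian A]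

variable {𝓔} in
theorem IsHalfExact.preservesFiniteLimits_extendDef {H : C ⥤ A} [H.Additive]
    (hH : 𝓔.IsHalfExact H) : PreservesFiniteLimits (𝓔.extendDef H) :=
  (𝓔.extendDef H).preservesFiniteLimits_iff_forall_exact_map_and_mono.2 fun _ hS =>
    ⟨(hH.map_extendDef_shortExact hS).exact, (hH.map_extendDef_shortExact hS).mono_f⟩

variable {𝓔} in
theorem IsHalfExact.preservesFiniteColimits_extendDef {H : C ⥤ A} [H.Additive]
    (hH : 𝓔.IsHalfExact H) : PreservesFiniteColimits (𝓔.extendDef H) :=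
  (𝓔.extendDef H).preservesFiniteColimits_iff_forall_exact_map_and_epi.2 fun _ hS =>
    ⟨(hH.map_extendDef_shortExact hS).exact, (hH.map_extendDef_shortExact hS).epi_g⟩

/-- The reflection of `C(-, X)` is presented by some `p : P ⟶ X` with `P` projective, so the
evaluation is a cokernel of `H p`, a morphism from the zero object. -/
theorem isIso_ev_unitElement (H : C ⥤ A) [H.Additive] (hP : 𝓔.HasEnoughProjectives)
    (hzero : ∀ P : C, 𝓔.IsProjective P → IsZero (H.obj P)) {Γ : FPMod C ⥤ 𝓔.Def}
    (adj : Γ ⊣ 𝓔.incl) (X : C) : IsIso (𝓔.ev H _ (𝓔.unitElement adj X)) := by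
  obtain ⟨P, p, hP, hp⟩ := 𝓔.exists_isProjective_isDeflation hP X
  have h := 𝓔.isPresentedBy_unitElement adj hP hp
  have := 𝓔.epi_ev H _ h.exists_map_eq
  have : Mono (𝓔.ev H _ (𝓔.unitElement adj X)) := by
    refine Preadditive.mono_of_cancel_zero _ fun {T} x hx => ?_
    obtain ⟨T', π, _, y, hy⟩ := 𝓔.exists_eq_comp_map_of_comp_ev_eq_zero H _ h x hx
    rw [← cancel_epi π, hy, (hzero P hP).eq_of_tgt y 0, zero_comp, comp_zero]
  exact isIso_of_mono_of_epi _

/-- A functor that vanishes on projective objects factors through the left adjoint of the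
inclusion of defects. -/
def isoExtendDef (H : C ⥤ A) [H.Additive] (hP : 𝓔.HasEnoughProjectives)
    (hzero : ∀ P : C, 𝓔.IsProjective P → IsZero (H.obj P)) {Γ : FPMod C ⥤ 𝓔.Def}
    (adj : Γ ⊣ 𝓔.incl) : H ≅ yonedaMod C ⋙ Γ ⋙ 𝓔.extendDef H :=
  NatIso.ofComponents
    (fun X => @asIso _ _ _ _ _ (𝓔.isIso_ev_unitElement H hP hzero adj X)) fun {X Y} f => by
      refine (𝓔.ev_map H _ f _).symm.trans ?_
      rw [← map_unitElement]
      exact (𝓔.ev_comp_map H _ _).symm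

variable {𝓔} in
theorem IsHalfExact.of_comp_faithful {B : Type u₂} [Category.{v₂} B] [Abelian B] {H : C ⥤ A}
    (hH : 𝓔.IsHalfExact H) {G : C ⥤ B} (F : B ⥤ A) [F.Additive] [F.Faithful]
    [PreservesFiniteLimits F] [PreservesFiniteColimits F] (e : H ≅ G ⋙ F) :
    𝓔.IsHalfExact G where
  additive := by
    have := hH.additive
    have := Functor.additive_of_iso e
    exact ⟨fun {X Y f g} => F.map_injective (by
      rw [F.map_add]
      exact (G ⋙ F).map_add)⟩
  exact {X Y Z} f g δ h := by
    obtain ⟨w, hw⟩ := hH.exact f g δ h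
    have w' : F.map (G.map f) ≫ F.map (G.map g) = 0 := by
      have := e.inv.naturality (f ≫ g)
      rw [H.map_comp, w, comp_zero] at this
      rw [← F.map_comp, ← G.map_comp]
      rw [← cancel_mono (e.inv.app Z), zero_comp]
      exact this
    have w₀ : G.map f ≫ G.map g = 0 := F.map_injective (by rw [F.map_comp, w', F.map_zero])
    refine ⟨w₀, F.reflects_exact_of_faithful _ ?_⟩
    exact ShortComplex.exact_of_iso
      (ShortComplex.isoMk (e.app X) (e.app Y) (e.app Z) (e.hom.naturality f).symm
        (e.hom.naturality g).symm) hw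

end ExtriangulatedStructure

end Extri

end

theorem mainTheorem4 {C : Type u} [Category.{v} C] [Preadditive C] [HasZeroObject C]
    [HasBinaryBiproducts C] (𝓔 : Extri.ExtriangulatedStructure C)
    (hP : 𝓔.HasEnoughProjectives)
    {A : Type u₁} [Category.{v₁} A] [Abelian A] (H : C ⥤ A) (hH : 𝓔.IsHalfExact H)
    (hzero : ∀ P : C, 𝓔.IsProjective P → IsZero (H.obj P)) :
    ∃ (B : Type (max u (v + 1))) (_ : Category.{max u (v + 1)} B) (_ : Abelian B) (G : C ⥤ B),
      𝓔.IsProjectivizationFunctor G ∧ Extri.IsFaithfullyExactReduction H G := by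
  have := hH.additive
  obtain ⟨Γ, ⟨adj⟩⟩ := (𝓔.isRightAdjoint_incl hP).exists_leftAdjoint
  let E := 𝓔.extendDef H
  have : PreservesFiniteLimits E := hH.preservesFiniteLimits_extendDef
  have : PreservesFiniteColimits E := hH.preservesFiniteColimits_extendDef
  -- The kernel of the exact functor `E` is the Serre subcategory by which to divide; it is the
  -- choice that makes the induced functor faithful.
  let S : ObjectProperty 𝓔.Def := ObjectProperty.inverseImage (IsZero (C := A)) E
  have hS : S.isoModSerre.IsInvertedBy E :=
    (S.isoModSerre_isInvertedBy_iff E).2 fun X hX => hX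
  let Q := S.isoModSerre.Q
  let : Abelian S.isoModSerre.Localization := ObjectProperty.SerreClassLocalization.abelian Q S
  let F : S.isoModSerre.Localization ⥤ A := Localization.lift E hS Q
  let e : Q ⋙ F ≅ E := Localization.fac E hS Q
  have : PreservesFiniteLimits F := by
    rw [← ObjectProperty.SerreClassLocalization.preservesFiniteLimits_comp_iff Q S]
    exact preservesFiniteLimits_of_natIso e.symm
  have : PreservesFiniteColimits F := by
    rw [← ObjectProperty.SerreClassLocalization.preservesFiniteColimits_comp_iff Q S]
    exact preservesFiniteColimits_of_natIso e.symm
  have : F.Additive := F.additive_of_preserves_binary_products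
  -- Each object of the quotient is some `Q D` up to isomorphism; if `F` kills it, then `E` kills
  -- `D`, so `D` lies in `S` and `Q D` is zero.
  have : F.Faithful := Extri.faithful_of_isZero F fun X hX => by
    have := Localization.essSurj Q S.isoModSerre
    let i := Q.objObjPreimageIso X
    refine IsZero.of_iso ((ObjectProperty.SerreClassLocalization.isZero_obj_iff Q S _).2 ?_) i.symm
    exact IsZero.of_iso hX ((e.app _).symm ≪≫ F.mapIso i)
  let i : H ≅ (Extri.yonedaMod C ⋙ Γ ⋙ Q) ⋙ F :=
    𝓔.isoExtendDef H hP hzero adj ≪≫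
      Functor.isoWhiskerLeft (Extri.yonedaMod C) (Functor.isoWhiskerLeft Γ e.symm)
  exact ⟨S.isoModSerre.Localization, inferInstance, inferInstance, Extri.yonedaMod C ⋙ Γ ⋙ Q,
    ⟨hH.of_comp_faithful F i, inferInstance, Γ, ⟨adj⟩, S, inferInstance, Q, inferInstance, rfl⟩,
    F, ‹_›, ‹_›, ‹_›, ‹_›, ⟨i⟩⟩
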